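/- Let $M$ be a graded monoid, i.e. a monoid with a length function $\ell\colon M\to\mathbb N$ such that $\ell(xy)=\ell(x)+\ell(y)$ and $\ell(x)=0$ only for $x=1_M$, and let $\mathbb K$ be a strong semiring, i.e. a Hausdorff topological semiring in which the product of two summable families is summable. For $k\in\mathbb K$ put $k^*=\sum_{n\ge 0}k^n$; $k$ is starrable if this family is summable. Series, i.e. maps $M\to\mathbb K$, carry the topology of pointwise convergence and the Cauchy product, and $s^*=\sum_{n\ge 0}s^n$. Expressions over $M$ with weights in $\mathbb K$ are given by $\mathsf E\to \mathsf 0\mid \mathsf 1\mid m\mid k\mathsf E\mid \mathsf E k\mid \mathsf E+\mathsf E\mid \mathsf E\cdot\mathsf E\mid \mathsf E^*$ with $m\in M\setminus\{1_M\}$, $k\in\mathbb K$ (equality of expressions is syntactic). The constant term $c(\mathsf E)$ is computed inductively by $c(\mathsf 0)=0$, $c(\mathsf 1)=1$, $c(m)=0$, $c(k\mathsf F)=k\,c(\mathsf F)$, $c(\mathsf Fk)=c(\mathsf F)k$, $c(\mathsf F+\mathsf G)=c(\mathsf F)+c(\mathsf G)$, $c(\mathsf F\cdot\mathsf G)=c(\mathsf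 F)c(\mathsf G)$, $c(\mathsf F^*)=c(\mathsf F)^*$; $\mathsf E$ is valid if $c(\mathsf F)$ is starrable for every subexpression $\mathsf F^*$ of $\mathsf E$. The denoted series $|\mathsf E|$ is defined by the obvious induction. A finite automaton $\mathcal A=\langle I,E,T\rangle$ of dimension $Q$ (a finite set) consists of $I,T\in\mathbb K^Q$ and a $Q\times Q$ matrix $E$ of finite $\mathbb K$-linear combinations of elements of $M\setminus\{1_M\}$; it realises the series $I\cdot E^*\cdot T$. A morphism from $\mathcal A$ onto $\mathcal B=\langle J,F,U\rangle$ of dimension $R$ is a surjection $\varphi\colon Q\to R$ whose $0$-$1$ matrix $X_\varphi$ satisfies $IX_\varphi=J$, $EX_\varphi=X_\varphi F$, $T=X_\varphi U$; then $\mathcal B$ is a quotient of $\mathcal A$. Let $Y_\varphi$ be obtained from the transpose of $X_\varphi$ by keeping exactly one $1$ in each row, and $\varphi(\mathcal A)=\langle IX_\varphi,\,Y_\varphi EX_\varphi,\,Y_\varphi T\rangle$. If $\varphi$ is a morphism from $\mathcal A$ onto some automaton, then this automaton is $\varphi(\mathcal A)$, whatever the choice of $Y_\varphi$. An automaton is standard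 if it has a single initial state, with initial weight $1$, which is the end of no transition. Write $$[J,F,c,U]=\Big\langle (1\;\;0),\ \begin{pmatrix}0&J\\0&F\end{pmatrix},\ \begin{pmatrix}c\\U\end{pmatrix}\Big\rangle .$$ For $\mathcal A=[J,F,c,U]$ and $\mathcal B=[K,G,d,V]$ put $k\mathcal A=[kJ,F,kc,U]$, $\mathcal Ak=[J,F,ck,Uk]$, $\mathcal A^*=[c^*J,\ U c^*J+F,\ c^*,\ Uc^*]$, $$\mathcal A+\mathcal B=\Big[(J\;\;K),\begin{pmatrix}F&0\\0&G\end{pmatrix},c+d,\begin{pmatrix}U\\V\end{pmatrix}\Big],\qquad \mathcal A\cdot\mathcal B=\Big[(J\;\;cK),\begin{pmatrix}F&UK\\0&G\end{pmatrix},cd,\begin{pmatrix}Ud\\V\end{pmatrix}\Big].$$ The standard (position) automaton $\mathcal S_{\mathsf E}$ is defined by induction from $\mathcal S_{\mathsf 0}=\langle(1),(0),(0)\rangle$, $\mathcal S_{\mathsf 1}=\langle(1),(0),(1)\rangle$, $\mathcal S_m=[(m),(0),0,(1)]$ by applying these operations. The set $D(\mathsf E)$ of derived terms is defined by $D(\mathsf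 0)=D(\mathsf 1)=\emptyset$, $D(m)=\{\mathsf 1\}$, $D(k\mathsf F)=D(\mathsf F)$, $D(\mathsf Fk)=\{\mathsf Hk:\mathsf H\in D(\mathsf F)\}$, $D(\mathsf F+\mathsf G)=D(\mathsf F)\cup D(\mathsf G)$, $D(\mathsf F\cdot\mathsf G)=\{\mathsf H\cdot\mathsf G:\mathsf H\in D(\mathsf F)\}\cup D(\mathsf G)$, $D(\mathsf F^*)=\{\mathsf H\cdot\mathsf F^*:\mathsf H\in D(\mathsf F)\}$. The standard derived-term automaton $\mathcal T_{\mathsf E}$, whose states are an initial state and the elements of $D(\mathsf E)$, is defined by induction: $\mathcal T_{\mathsf E}=\mathcal S_{\mathsf E}$ if $\mathsf E$ is $\mathsf 0$, $\mathsf 1$ or an atom $m$; $\mathcal T_{k\mathsf F}=k\mathcal T_{\mathsf F}$, and, up to the renaming of the states, $\mathcal T_{\mathsf Fk}=\mathcal T_{\mathsf F}k$ and $\mathcal T_{\mathsf F^*}=(\mathcal T_{\mathsf F})^*$; finally $\mathcal T_{\mathsf F+\mathsf G}=\varphi(\mathcal T_{\mathsf F}+\mathcal T_{\mathsf G})$ and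 $\mathcal T_{\mathsf F\cdot\mathsf G}=\psi(\mathcal T_{\mathsf F}\cdot\mathcal T_{\mathsf G})$, where $\varphi\colon D(\mathsf F)\sqcup D(\mathsf G)\to D(\mathsf F+\mathsf G)$ and $\psi\colon D(\mathsf F)\sqcup D(\mathsf G)\to D(\mathsf F\cdot\mathsf G)$ are the natural maps ($\psi$ sends $\mathsf H\in D(\mathsf F)$ to $\mathsf H\cdot\mathsf G$), extended to the initial state. **Theorem.** Let $\mathsf E$ be a valid expression over $M$ with weights in $\mathbb K$. The construction of $\mathcal T_{\mathsf E}$ makes sense: if $\mathsf E=\mathsf F+\mathsf G$, then $\varphi$ is a morphism from $\mathcal T_{\mathsf F}+\mathcal T_{\mathsf G}$ onto $\mathcal T_{\mathsf E}$, and if $\mathsf E=\mathsf F\cdot\mathsf G$, then $\psi$ is a morphism from $\mathcal T_{\mathsf F}\cdot\mathcal T_{\mathsf G}$ onto $\mathcal T_{\mathsf E}$. The automaton $\mathcal T_{\mathsf E}$ is standard. The series $|\mathsf E|$ is defined (all products and stars in its definition exist), $\mathcal T_{\mathsf E}$ realises $|\mathsf E|$, and $\mathcal T_{\mathsf E}$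 is a quotient of $\mathcal S_{\mathsf E}$. -/

import Mathlib

open scoped BigOperators

noncomputable section

namespace WRat

universe u v w w'

/-! ## Graded monoids, strong semirings, series -/

/-- A graded monoid: a monoid with an additive length function with values in `ℕ` such that the
identity is the only element of length `0`. -/
def IsGraded (M : Type v) [Monoid M] : Prop :=
  ∃ len : M → ℕ, (∀ x y, len (x * y) = len x + len y) ∧ ∀ x, len x = 0 ↔ x = 1

/-- A topological semiring is strong if the product of two summable families is summable. -/
def IsStrong (K : Type u) [Semiring K] [TopologicalSpace K] : Prop :=
  ∀ (ι κ : Type) (f : ι → K) (g : κ → K), Summable f → Summable g →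
    Summable fun p : ι × κ => f p.1 * g p.2

/-- `k` is starrable if the family of its powers is summable. -/
def Starrable {K : Type u} [Semiring K] [TopologicalSpace K] (k : K) : Prop :=
  Summable fun n : ℕ => k ^ n

/-- The star of `k`, i.e. the sum of all its powers. -/
def kstar {K : Type u} [Semiring K] [TopologicalSpace K] (k : K) : K :=
  ∑' n : ℕ, k ^ n

/-- Formal power series over `M` with coefficients in `K`, with the topology of pointwise
convergence. -/
abbrev Series (K : Type u) (M : Type v) := M → K

namespace Series

variable {K : Type u} {M : Type v} [Semiring K] [Monoid M]

open Classical in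
/-- The series `k m`. -/
def monomial (m : M) (k : K) : Series K M := fun x => if x = m then k else 0

/-- The Cauchy product `(s t)(m) = ∑_{u v = m} s(u) t(v)`. -/
def mul (s t : Series K M) : Series K M :=
  fun m => ∑ᶠ p : {p : M × M // p.1 * p.2 = m}, s p.1.1 * t p.1.2

/-- The sums that define the Cauchy product of `s` and `t` are all finite. -/
def MulDefined (s t : Series K M) : Prop :=
  ∀ m, {p : M × M | p.1 * p.2 = m ∧ s p.1 ≠ 0 ∧ t p.2 ≠ 0}.Finite

/-- Powers for the Cauchy product. -/
def pow (s : Series K M) : ℕ → Series K M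
  | 0 => monomial 1 1
  | n + 1 => mul (pow s n) s

/-- The star of a series, i.e. the sum of all its powers. -/
def star [TopologicalSpace K] (s : Series K M) : Series K M := ∑' n : ℕ, pow s n

/-- All the powers of `s` are defined, and they form a summable family. -/
def StarDefined [TopologicalSpace K] (s : Series K M) : Prop :=
  (∀ n, MulDefined (pow s n) s) ∧ Summable fun n : ℕ => pow s n

end Series

/-! ## Weighted rational expressions -/

/-- Rational expressions over `M` with weights in `K`; the atoms are the elements of `M` other than
the identity. -/
inductive RatExp (K : Type u) (M : Type v) [Monoid M] : Type (max u v)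
  | zero : RatExp K M
  | one : RatExp K M
  | atom (m : M) (hm : m ≠ 1) : RatExp K M
  | lmul (k : K) (E : RatExp K M) : RatExp K M
  | rmul (E : RatExp K M) (k : K) : RatExp K M
  | add (E F : RatExp K M) : RatExp K M
  | mul (E F : RatExp K M) : RatExp K M
  | star (E : RatExp K M) : RatExp K M

namespace RatExp

variable {K : Type u} {M : Type v} [Semiring K] [Monoid M]

/-- The constant term of an expression (meaningful for valid expressions). -/
def constTerm [TopologicalSpace K] : RatExp K M → K
  | zero => 0
  | one => 1
  | atom _ _ => 0
  | lmul k F => k * constTerm F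
  | rmul F k => constTerm F * k
  | add F G => constTerm F + constTerm G
  | mul F G => constTerm F * constTerm G
  | star F => kstar (constTerm F)

/-- An expression is valid if for each of its starred subexpressions `F*` the constant term of `F`
is starrable. -/
def Valid [TopologicalSpace K] : RatExp K M → Prop
  | zero => True
  | one => True
  | atom _ _ => True
  | lmul _ F => Valid F
  | rmul F _ => Valid F
  | add F G => Valid F ∧ Valid G
  | mul F G => Valid F ∧ Valid G
  | star F => Valid F ∧ Starrable (constTerm F)

/-- The series denoted by an expression. -/
def series [TopologicalSpace K] : RatExp K M → Series K M
  | zero => fun _ => 0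
  | one => Series.monomial 1 1
  | atom m _ => Series.monomial m 1
  | lmul k F => fun x => k * series F x
  | rmul F k => fun x => series F x * k
  | add F G => fun x => series F x + series G x
  | mul F G => Series.mul (series F) (series G)
  | star F => Series.star (series F)

/-- All the products and stars of series in the definition of the series denoted by an expression
are defined. -/
def SeriesDefined [TopologicalSpace K] : RatExp K M → Prop
  | zero => True
  | one => True
  | atom _ _ => True
  | lmul _ F => SeriesDefined F
  | rmul F _ => SeriesDefined F
  | add F G => SeriesDefined F ∧ SeriesDefined G
  | mul F G => SeriesDefined F ∧ SeriesDefined G ∧ Series.MulDefined (series F) (series G)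
  | star F => SeriesDefined F ∧ Series.StarDefined (series F)

end RatExp

/-! ## Finite automata, conjugacy, morphisms -/

/-- A `K`-automaton over `M` of finite dimension `Q`: an initial row vector `I`, a transition
matrix `E` whose entries are finite linear combinations of elements of `M` other than the identity,
and a final column vector `T`. -/
structure Aut (K : Type u) (M : Type v) [Semiring K] [Monoid M] (Q : Type w) where
  I : Q → K
  E : Matrix Q Q (MonoidAlgebra K M)
  T : Q → K
  proper : ∀ p q, (E p q).coeff 1 = 0

namespace Aut

variable {K : Type u} {M : Type v} [Semiring K] [Monoid M] {Q : Type w} {R : Type w'}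
  [Fintype Q] [Fintype R]

open Classical in
/-- `A` realises `s`, i.e. `s` is the behaviour `I · E* · T` of `A`: every entry of
`E* = ∑ₙ Eⁿ` is a well-defined series, and `s = ∑_{p,q} I(p) E*(p,q) T(q)`. -/
def Realises [TopologicalSpace K] (A : Aut K M Q) (s : Series K M) : Prop :=
  ∃ S : Q → Q → Series K M,
    (∀ p q, HasSum (fun n : ℕ => ((fun m => ((A.E ^ n) p q).coeff m) : Series K M)) (S p q)) ∧
    s = fun m => ∑ p, ∑ q, A.I p * S p q m * A.T q

/-- `A` is standard with initial state `i`: `i` is the only initial state, its initial weight is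
`1`, and it is the end of no transition. -/
def IsStandard (A : Aut K M Q) (i : Q) : Prop :=
  A.I i = 1 ∧ (∀ p, p ≠ i → A.I p = 0) ∧ ∀ p, A.E p i = 0

/-- `A` is conjugate to `B` by the `K`-matrix `X`: `I X = J`, `E X = X F` and `T = X U`. -/
def ConjBy (A : Aut K M Q) (B : Aut K M R) (X : Matrix Q R K) : Prop :=
  Matrix.vecMul A.I X = B.I ∧
  A.E * X.map (MonoidAlgebra.single (1 : M)) = X.map (MonoidAlgebra.single (1 : M)) * B.E ∧
  A.T = Matrix.mulVec X B.T

open Classical in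
/-- The amalgamation matrix of a map. -/
def amalgamation (K : Type u) [Semiring K] {Q : Type w} {R : Type w'} (φ : Q → R) :
    Matrix Q R K :=
  Matrix.of fun q r => if φ q = r then 1 else 0

/-- `φ` is a morphism from `A` onto `B`. -/
def IsMorphism (A : Aut K M Q) (B : Aut K M R) (φ : Q → R) : Prop :=
  Function.Surjective φ ∧ A.ConjBy B (amalgamation K φ)

/-- `B` is a quotient of `A`. -/
def IsQuotient (B : Aut K M R) (A : Aut K M Q) : Prop :=
  ∃ φ : Q → R, IsMorphism A B φ

end Aut

/-! ## Standard automata and the rational operations on them -/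

/-- The blocks of a standard automaton of dimension `Q`
`⟨(1 0), (0 J; 0 F), (c; U)⟩`, whose set of states is `Q` with an initial state added. -/
structure StdAut (K : Type u) (M : Type v) [Semiring K] [Monoid M] (Q : Type w) where
  J : Q → MonoidAlgebra K M
  F : Matrix Q Q (MonoidAlgebra K M)
  c : K
  U : Q → K
  J_proper : ∀ q, (J q).coeff 1 = 0
  F_proper : ∀ p q, (F p q).coeff 1 = 0

namespace StdAut

variable {K : Type u} {M : Type v} [Semiring K] [Monoid M] {Q : Type w} {R : Type w'}

/-- The automaton with the given blocks; its initial state is `none`. -/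
def toAut (A : StdAut K M Q) : Aut K M (Option Q) where
  I
    | none => 1
    | some _ => 0
  E := Matrix.of fun
    | none, some q => A.J q
    | some p, some q => A.F p q
    | _, none => 0
  T
    | none => A.c
    | some q => A.U q
  proper := by
    rintro (_ | p) (_ | q) <;> simp [A.J_proper, A.F_proper]

/-- `⟨(1), (0), (c)⟩`, of dimension `∅`. -/
def const (Q : Type w) [IsEmpty Q] (c : K) : StdAut K M Q where
  J := isEmptyElim
  F := Matrix.of isEmptyElim
  c := c
  U := isEmptyElim
  J_proper := isEmptyElim
  F_proper := isEmptyElim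

/-- `⟨(1 0), (0 m; 0 0), (0; 1)⟩`, of dimension a singleton. -/
def letter (Q : Type w) [Unique Q] (m : M) (hm : m ≠ 1) : StdAut K M Q where
  J _ := MonoidAlgebra.single m 1
  F := 0
  c := 0
  U _ := 1
  J_proper _ := by simp [MonoidAlgebra.coeff_single, hm]
  F_proper _ _ := by simp

/-- `k A`. -/
def lmul (k : K) (A : StdAut K M Q) : StdAut K M Q where
  J q := k • A.J q
  F := A.F
  c := k * A.c
  U := A.U
  J_proper q := by simp [A.J_proper]
  F_proper := A.F_proper

/-- `A k`. -/
def rmul (A : StdAut K M Q) (k : K) : StdAut K M Q where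
  J := A.J
  F := A.F
  c := A.c * k
  U q := A.U q * k
  J_proper := A.J_proper
  F_proper := A.F_proper

/-- `A + B`. -/
def add (A : StdAut K M Q) (B : StdAut K M R) : StdAut K M (Q ⊕ R) where
  J := Sum.elim A.J B.J
  F := Matrix.fromBlocks A.F 0 0 B.F
  c := A.c + B.c
  U := Sum.elim A.U B.U
  J_proper := by rintro (p | p) <;> simp [A.J_proper, B.J_proper]
  F_proper := by rintro (p | p) (q | q) <;> simp [A.F_proper, B.F_proper]

/-- `A · B`. -/
def mul (A : StdAut K M Q) (B : StdAut K M R) : StdAut K M (Q ⊕ R) where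
  J := Sum.elim A.J fun r => A.c • B.J r
  F := Matrix.fromBlocks A.F (Matrix.of fun q r => A.U q • B.J r) 0 B.F
  c := A.c * B.c
  U := Sum.elim (fun q => A.U q * B.c) B.U
  J_proper := by rintro (p | p) <;> simp [A.J_proper, B.J_proper]
  F_proper := by rintro (p | p) (q | q) <;> simp [A.F_proper, B.F_proper, B.J_proper]

/-- `A*` (meaningful if the constant term of `A` is starrable). -/
def star [TopologicalSpace K] (A : StdAut K M Q) : StdAut K M Q where
  J q := kstar A.c • A.J q
  F := Matrix.of fun p q => (A.U p * kstar A.c) • A.J q + A.F p q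
  c := kstar A.c
  U q := A.U q * kstar A.c
  J_proper q := by simp [A.J_proper]
  F_proper p q := by simp [A.J_proper, A.F_proper]

/-- Renaming of the states along a bijection. -/
def reindex (e : Q ≃ R) (A : StdAut K M Q) : StdAut K M R where
  J r := A.J (e.symm r)
  F := Matrix.of fun r r' => A.F (e.symm r) (e.symm r')
  c := A.c
  U r := A.U (e.symm r)
  J_proper _ := A.J_proper _
  F_proper _ _ := A.F_proper _ _

open Classical in
/-- The image `φ(A) = ⟨I·X, Y·E·X, Y·T⟩` of a standard automaton under a surjective map `φ` of its
non-initial states, where `X` is the amalgamation matrix of `φ` (extended to the initial state) and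
`Y` the selection matrix that picks a representative in each class of the map equivalence of `φ`.
If `φ` is a morphism then this does not depend on the representatives. -/
def image [Fintype Q] (A : StdAut K M Q) (φ : Q → R) (hφ : Function.Surjective φ) :
    StdAut K M R where
  J r := ∑ q, if φ q = r then A.J q else 0
  F := Matrix.of fun r r' => ∑ q, if φ q = r' then A.F (Function.surjInv hφ r) q else 0
  c := A.c
  U r := A.U (Function.surjInv hφ r)
  J_proper r := by
    rw [MonoidAlgebra.coeff_sum, Finsupp.finsetSum_apply]
    refine Finset.sum_eq_zero fun q _ => ?_
    split_ifs <;> simp [A.J_proper]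
  F_proper r r' := by
    rw [Matrix.of_apply, MonoidAlgebra.coeff_sum, Finsupp.finsetSum_apply]
    refine Finset.sum_eq_zero fun q _ => ?_
    split_ifs <;> simp [A.F_proper]

end StdAut

namespace RatExp

variable {K : Type u} {M : Type v} [Semiring K] [Monoid M]

/-! ## The standard (position) automaton of an expression -/

/-- The set of positions of the atoms of an expression. -/
def Pos : RatExp K M → Type
  | zero => Empty
  | one => Empty
  | atom _ _ => Unit
  | lmul _ F => Pos F
  | rmul F _ => Pos F
  | add F G => Pos F ⊕ Pos G
  | mul F G => Pos F ⊕ Pos G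
  | star F => Pos F

/-- There are finitely many positions. -/
instance instFintypePos : (E : RatExp K M) → Fintype (Pos E)
  | zero => inferInstanceAs (Fintype Empty)
  | one => inferInstanceAs (Fintype Empty)
  | atom _ _ => inferInstanceAs (Fintype Unit)
  | lmul _ F => instFintypePos F
  | rmul F _ => instFintypePos F
  | add F G =>
    letI := instFintypePos F
    letI := instFintypePos G
    inferInstanceAs (Fintype (Pos F ⊕ Pos G))
  | mul F G =>
    letI := instFintypePos F
    letI := instFintypePos G
    inferInstanceAs (Fintype (Pos F ⊕ Pos G))
  | star F => instFintypePos F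

/-- The standard automaton (position automaton) `S_E` of an expression `E`. -/
def stan [TopologicalSpace K] : (E : RatExp K M) → StdAut K M (Pos E)
  | zero => StdAut.const Empty 0
  | one => StdAut.const Empty 1
  | atom m hm => StdAut.letter Unit m hm
  | lmul k F => (stan F).lmul k
  | rmul F k => (stan F).rmul k
  | add F G => (stan F).add (stan G)
  | mul F G => (stan F).mul (stan G)
  | star F => (stan F).star

end RatExp

namespace RatExp

variable {K : Type u} {M : Type v} [Monoid M]

/-! ## Derived terms and the standard derived-term automaton -/

open Classical in
/-- The (finite) set of derived terms of an expression. -/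
def derTer : RatExp K M → Finset (RatExp K M)
  | zero => ∅
  | one => ∅
  | atom _ _ => {one}
  | lmul _ F => derTer F
  | rmul F k => (derTer F).image fun H => rmul H k
  | add F G => derTer F ∪ derTer G
  | mul F G => (derTer F).image (fun H => mul H G) ∪ derTer G
  | star F => (derTer F).image fun H => mul H (star F)

instance instIsEmptyDerTerZero : IsEmpty ↥(derTer (zero : RatExp K M)) :=
  ⟨fun x => Finset.notMem_empty _ x.2⟩

instance instIsEmptyDerTerOne : IsEmpty ↥(derTer (one : RatExp K M)) :=
  ⟨fun x => Finset.notMem_empty _ x.2⟩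

instance instUniqueDerTerAtom (m : M) (hm : m ≠ 1) :
    Unique ↥(derTer (atom m hm : RatExp K M)) where
  default := ⟨one, Finset.mem_singleton_self _⟩
  uniq x := Subtype.ext (Finset.mem_singleton.1 x.2)

/-- The bijection `H ↦ H k` from the derived terms of `F` onto those of `F k`. -/
def derTerRmulEquiv (F : RatExp K M) (k : K) : ↥(derTer F) ≃ ↥(derTer (rmul F k)) :=
  Equiv.ofBijective
    (fun H => ⟨rmul H.1 k, by classical exact Finset.mem_image_of_mem _ H.2⟩) <| by
      classical
      refine ⟨fun H H' h => ?_, fun L => ?_⟩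
      · have h1 := congrArg Subtype.val h
        injection h1 with h2
        exact Subtype.ext h2
      · obtain ⟨H, hH, hL⟩ := Finset.mem_image.1 L.2
        exact ⟨⟨H, hH⟩, Subtype.ext hL⟩

/-- The bijection `H ↦ H · F*` from the derived terms of `F` onto those of `F*`. -/
def derTerStarEquiv (F : RatExp K M) : ↥(derTer F) ≃ ↥(derTer (star F)) :=
  Equiv.ofBijective
    (fun H => ⟨mul H.1 (star F), by classical exact Finset.mem_image_of_mem _ H.2⟩) <| by
      classical
      refine ⟨fun H H' h => ?_, fun L => ?_⟩
      · have h1 := congrArg Subtype.val h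
        injection h1 with h2
        exact Subtype.ext h2
      · obtain ⟨H, hH, hL⟩ := Finset.mem_image.1 L.2
        exact ⟨⟨H, hH⟩, Subtype.ext hL⟩

/-- The natural map from the disjoint union of the sets of derived terms of `F` and `G` onto the
set of derived terms of `F + G`. -/
def addMap (F G : RatExp K M) : ↥(derTer F) ⊕ ↥(derTer G) → ↥(derTer (add F G))
  | Sum.inl H => ⟨H.1, by classical exact Finset.mem_union_left _ H.2⟩
  | Sum.inr H => ⟨H.1, by classical exact Finset.mem_union_right _ H.2⟩

theorem addMap_surjective (F G : RatExp K M) : Function.Surjective (addMap F G) := by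
  classical
  intro L
  rcases Finset.mem_union.1 L.2 with h | h
  · exact ⟨Sum.inl ⟨L.1, h⟩, rfl⟩
  · exact ⟨Sum.inr ⟨L.1, h⟩, rfl⟩

/-- The natural map from the disjoint union of the sets of derived terms of `F`, each multiplied by
`G`, and of `G` onto the set of derived terms of `F · G`. -/
def mulMap (F G : RatExp K M) : ↥(derTer F) ⊕ ↥(derTer G) → ↥(derTer (mul F G))
  | Sum.inl H => ⟨mul H.1 G, by
      classical exact Finset.mem_union_left _ (Finset.mem_image_of_mem _ H.2)⟩
  | Sum.inr H => ⟨H.1, by classical exact Finset.mem_union_right _ H.2⟩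

theorem mulMap_surjective (F G : RatExp K M) : Function.Surjective (mulMap F G) := by
  classical
  intro L
  rcases Finset.mem_union.1 L.2 with h | h
  · obtain ⟨H, hH, hL⟩ := Finset.mem_image.1 h
    exact ⟨Sum.inl ⟨H, hH⟩, Subtype.ext hL⟩
  · exact ⟨Sum.inr ⟨L.1, h⟩, rfl⟩

/-- The standard derived-term automaton `T_E` of an expression `E`, of dimension the set of derived
terms of `E`. -/
def term [Semiring K] [TopologicalSpace K] : (E : RatExp K M) → StdAut K M ↥(derTer E)
  | zero => StdAut.const _ 0
  | one => StdAut.const _ 1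
  | atom m hm => StdAut.letter _ m hm
  | lmul k F => (term F).lmul k
  | rmul F k => ((term F).rmul k).reindex (derTerRmulEquiv F k)
  | add F G => ((term F).add (term G)).image (addMap F G) (addMap_surjective F G)
  | mul F G => ((term F).mul (term G)).image (mulMap F G) (mulMap_surjective F G)
  | star F => (term F).star.reindex (derTerStarEquiv F)

end RatExp

end WRat

end

/-!
A state of a derived-term automaton is labelled by an expression `H`, and its row computes the
differential `∂(H)`: a formal linear combination of derived terms with coefficients in the monoid
algebra. The operations on automata act on the differentials of the labels alone, so that any two
automata whose labels agree are related by the map of states that preserves the labels.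

For a valid expression `|H| = c(H) + ∑ ∂_{H'}(H) |H'|`, the sum being over the derived terms `H'`:
at a star, the constant term splits off as the solution of a linear recursion in `K`. The series
denoted by the labels thus solve `β = T + E β`, and this equation has no other solution than
`E* T`, as `E` is proper. Only finitely many elements of `M` occur in all of this; each element of
the submonoid that they generate has finitely many factorisations, so that the series over that
submonoid form a semiring.
-/

noncomputable section

namespace WRat

section Pushforward

variable {Q R S A : Type*} [Fintype Q]

/-- The push-forward of the family `f` along `φ`: the entry at `r` is the sum of `f` over the fibre
of `φ` at `r`. It is finitely supported, so that the target of `φ` need not be finite. -/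
def pushforward [AddCommMonoid A] (φ : Q → R) (f : Q → A) : R →₀ A :=
  ∑ q, Finsupp.single (φ q) (f q)

theorem pushforward_apply [AddCommMonoid A] [DecidableEq R] (φ : Q → R) (f : Q → A) (r : R) :
    pushforward φ f r = ∑ q, if φ q = r then f q else 0 := by
  simp only [pushforward, Finsupp.finsetSum_apply, Finsupp.single_apply]

theorem pushforward_of_isEmpty [AddCommMonoid A] [IsEmpty Q] (φ : Q → R) (f : Q → A) :
    pushforward φ f = 0 := by
  simp only [pushforward, Finset.univ_eq_empty, Finset.sum_empty]

theorem pushforward_of_unique [AddCommMonoid A] [Unique Q] (φ : Q → R) (f : Q → A) :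
    pushforward φ f = Finsupp.single (φ default) (f default) := by
  rw [pushforward, Fintype.sum_unique]

theorem pushforward_zero [AddCommMonoid A] (φ : Q → R) : pushforward φ (0 : Q → A) = 0 := by
  simp only [pushforward, Pi.zero_apply, Finsupp.single_zero, Finset.sum_const_zero]

theorem pushforward_add [AddCommMonoid A] (φ : Q → R) (f g : Q → A) :
    pushforward φ (f + g) = pushforward φ f + pushforward φ g := by
  simp only [pushforward, Pi.add_apply, Finsupp.single_add, Finset.sum_add_distrib]

theorem pushforward_smul {k : Type*} [AddCommMonoid A] [DistribSMul k A] (φ : Q → R) (c : k)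
    (f : Q → A) : pushforward φ (c • f) = c • pushforward φ f := by
  simp only [pushforward, Pi.smul_apply, Finset.smul_sum, Finsupp.smul_single]

theorem pushforward_sumElim [Fintype S] [AddCommMonoid A] (φ : Q → R) (ψ : S → R) (f : Q → A)
    (g : S → A) :
    pushforward (Sum.elim φ ψ) (Sum.elim f g) = pushforward φ f + pushforward ψ g := by
  simp only [pushforward, Fintype.sum_sum_type, Sum.elim_inl, Sum.elim_inr]

theorem mapDomain_pushforward [AddCommMonoid A] (φ : Q → R) (ψ : R → S) (f : Q → A) :
    Finsupp.mapDomain ψ (pushforward φ f) = pushforward (ψ ∘ φ) f := by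
  simp only [pushforward, Finsupp.mapDomain_finsetSum, Finsupp.mapDomain_single,
    Function.comp_apply]

theorem mapDomain_eq_pushforward [Fintype R] [AddCommMonoid A] (ψ : R → S) (f : R →₀ A) :
    Finsupp.mapDomain ψ f = pushforward ψ f :=
  Finsupp.sum_fintype f _ fun _ => Finsupp.single_zero _

theorem pushforward_coe_pushforward [Fintype R] [AddCommMonoid A] (φ : Q → R) (ψ : R → S)
    (f : Q → A) : pushforward ψ (pushforward φ f) = pushforward (ψ ∘ φ) f := by
  rw [← mapDomain_pushforward, mapDomain_eq_pushforward]

theorem coe_pushforward_eq_of_injective [Fintype R] [AddCommMonoid A] {φ : Q → R} {ψ : R → S}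
    (hψ : Function.Injective ψ) {f : Q → A} {g : R → A}
    (h : pushforward (ψ ∘ φ) f = pushforward ψ g) : ⇑(pushforward φ f) = g := by
  have : pushforward φ f = Finsupp.equivFunOnFinite.symm g := Finsupp.mapDomain_injective hψ <| by
    rw [mapDomain_pushforward, h, mapDomain_eq_pushforward, Finsupp.coe_equivFunOnFinite_symm]
  rw [this, Finsupp.coe_equivFunOnFinite_symm]

theorem pushforward_comp_equiv_symm [Fintype R] [AddCommMonoid A] (e : Q ≃ R) (φ : R → S)
    (f : Q → A) : pushforward φ (f ∘ e.symm) = pushforward (φ ∘ e) f := by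
  rw [pushforward, pushforward, ← e.sum_comp]
  simp only [Function.comp_apply, Equiv.symm_apply_apply]

end Pushforward

namespace Aut

variable {K M Q R : Type*} [Semiring K]

theorem mul_map_amalgamation_apply [Monoid M] [Fintype Q] {P : Type*}
    (E : Matrix P Q (MonoidAlgebra K M)) (φ : Q → R) (p : P) (r : R) :
    (E * (amalgamation K φ).map (MonoidAlgebra.single (1 : M))) p r =
      pushforward φ (E p) r := by
  classical
  rw [Matrix.mul_apply, pushforward_apply]
  refine Finset.sum_congr rfl fun q _ => ?_
  simp only [amalgamation, Matrix.map_apply, Matrix.of_apply]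
  split_ifs
  · rw [← MonoidAlgebra.one_def, mul_one]
  · rw [MonoidAlgebra.single_zero, mul_zero]

theorem map_amalgamation_mul_apply [Monoid M] [Fintype R] {P : Type*}
    (F : Matrix R P (MonoidAlgebra K M)) (φ : Q → R) (q : Q) (p : P) :
    ((amalgamation K φ).map (MonoidAlgebra.single (1 : M)) * F) q p = F (φ q) p := by
  classical
  rw [Matrix.mul_apply, Finset.sum_eq_single (φ q)]
  · simp [amalgamation, ← MonoidAlgebra.one_def]
  · intro r _ hr
    simp [amalgamation, hr.symm]
  · simp

theorem amalgamation_mulVec [Fintype R] (φ : Q → R) (v : R → K) :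
    (amalgamation K φ).mulVec v = v ∘ φ := by
  classical
  ext q
  rw [Matrix.mulVec, dotProduct, Finset.sum_eq_single (φ q)]
  · simp [amalgamation]
  · intro r _ hr
    simp [amalgamation, hr.symm]
  · simp

theorem vecMul_amalgamation [Fintype Q] (φ : Q → R) (v : Q → K) :
    Matrix.vecMul v (amalgamation K φ) = pushforward φ v := by
  classical
  ext r
  rw [Matrix.vecMul, dotProduct, pushforward_apply]
  simp only [amalgamation, Matrix.of_apply, mul_ite, mul_one, mul_zero]

end Aut

namespace StdAut

variable {K M Q R : Type*} [Semiring K] [Monoid M]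

open Aut in
theorem isMorphism_toAut [Fintype Q] [Fintype R] {A : StdAut K M Q} {B : StdAut K M R} {φ : Q → R}
    (hφ : Function.Surjective φ) (hJ : ⇑(pushforward φ A.J) = B.J)
    (hF : ∀ p, ⇑(pushforward φ (A.F p)) = B.F (φ p)) (hc : A.c = B.c) (hU : A.U = B.U ∘ φ) :
    Aut.IsMorphism A.toAut B.toAut (Option.map φ) := by
  classical
  refine ⟨fun r => ?_, ?_, ?_, ?_⟩
  · rcases r with _ | r
    · exact ⟨none, rfl⟩
    · exact (hφ r).imp' some fun _ => congrArg some
  · ext r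
    rw [vecMul_amalgamation, pushforward_apply, Fintype.sum_option]
    cases r <;> simp [toAut]
  · ext1 p r
    rw [mul_map_amalgamation_apply, map_amalgamation_mul_apply, pushforward_apply,
      Fintype.sum_option]
    rcases p with _ | p <;> rcases r with _ | r <;>
      simp [toAut, ← hJ, ← hF, pushforward_apply]
  · rw [amalgamation_mulVec]
    ext q
    cases q <;> simp [toAut, hc, hU]

theorem toAut_isStandard (A : StdAut K M Q) : A.toAut.IsStandard none :=
  ⟨rfl, by rintro (_ | p) hp <;> [exact absurd rfl hp; rfl], by rintro (_ | p) <;> rfl⟩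

end StdAut

namespace RatExp

variable {K M : Type*} [Semiring K] [Monoid M] [TopologicalSpace K]

/-- The differential of an expression, as a finite linear combination of expressions with
coefficients in `MonoidAlgebra K M`; the derived terms are the expressions that may occur in it. -/
def differential : RatExp K M → RatExp K M →₀ MonoidAlgebra K M
  | zero => 0
  | one => 0
  | atom m _ => Finsupp.single one (MonoidAlgebra.single m 1)
  | lmul k F => k • differential F
  | rmul F k => (differential F).mapDomain (rmul · k)
  | add F G => differential F + differential G
  | mul F G => (differential F).mapDomain (mul · G) + constTerm F • differential G
  | star F => kstar (constTerm F) • (differential F).mapDomain (mul · (star F))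

end RatExp

namespace StdAut

variable {K M Q R : Type*} [Semiring K] [Monoid M] [TopologicalSpace K] [Fintype Q]

/-- The label `ℓ q` of each state `q` of `A` is an expression of which the row of `q` computes the
differential and the constant term, and likewise `E` for the initial state. Standard automata that
are labelled by derived terms of the same expression are compared through their labels. -/
structure IsLabelling (A : StdAut K M Q) (E : RatExp K M) (ℓ : Q → RatExp K M) : Prop where
  J_eq : pushforward ℓ A.J = RatExp.differential E
  F_eq : ∀ q, pushforward ℓ (A.F q) = RatExp.differential (ℓ q)
  c_eq : A.c = RatExp.constTerm E
  U_eq : ∀ q, A.U q = RatExp.constTerm (ℓ q)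

variable {A : StdAut K M Q} {E F G : RatExp K M} {ℓ : Q → RatExp K M}

namespace IsLabelling

theorem const_zero [IsEmpty Q] (ℓ : Q → RatExp K M) : (const Q 0).IsLabelling .zero ℓ :=
  ⟨pushforward_of_isEmpty _ _, isEmptyElim, rfl, isEmptyElim⟩

theorem const_one [IsEmpty Q] (ℓ : Q → RatExp K M) : (const Q 1).IsLabelling .one ℓ :=
  ⟨pushforward_of_isEmpty _ _, isEmptyElim, rfl, isEmptyElim⟩

theorem letter [Unique Q] {m : M} (hm : m ≠ 1) (hℓ : ℓ default = .one) :
    (letter Q m hm).IsLabelling (.atom m hm) ℓ where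
  J_eq := by rw [pushforward_of_unique, hℓ]; rfl
  F_eq q := by rw [Unique.eq_default q, hℓ]; exact pushforward_zero _
  c_eq := rfl
  U_eq q := by rw [Unique.eq_default q, hℓ]; rfl

theorem lmul (h : A.IsLabelling F ℓ) (k : K) : (A.lmul k).IsLabelling (.lmul k F) ℓ where
  J_eq := (pushforward_smul ℓ k A.J).trans (congrArg (k • ·) h.J_eq)
  F_eq := h.F_eq
  c_eq := congrArg (k * ·) h.c_eq
  U_eq := h.U_eq

theorem rmul (h : A.IsLabelling F ℓ) (k : K) :
    (A.rmul k).IsLabelling (.rmul F k) fun q => .rmul (ℓ q) k where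
  J_eq := by
    rw [RatExp.differential, ← h.J_eq, mapDomain_pushforward]; rfl
  F_eq q := by
    rw [RatExp.differential, ← h.F_eq, mapDomain_pushforward]; rfl
  c_eq := congrArg (· * k) h.c_eq
  U_eq q := congrArg (· * k) (h.U_eq q)

theorem add [Fintype R] {B : StdAut K M R} {ℓ' : R → RatExp K M} (hA : A.IsLabelling F ℓ)
    (hB : B.IsLabelling G ℓ') : (A.add B).IsLabelling (.add F G) (Sum.elim ℓ ℓ') where
  J_eq := by
    rw [RatExp.differential, ← hA.J_eq, ← hB.J_eq]
    exact pushforward_sumElim ..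
  F_eq := by
    rintro (p | p)
    · rw [Sum.elim_inl, ← hA.F_eq, ← add_zero (pushforward ℓ _), ← pushforward_zero ℓ',
        ← pushforward_sumElim]
      rfl
    · rw [Sum.elim_inr, ← hB.F_eq, ← zero_add (pushforward ℓ' _), ← pushforward_zero ℓ,
        ← pushforward_sumElim]
      rfl
  c_eq := congrArg₂ (· + ·) hA.c_eq hB.c_eq
  U_eq := by
    rintro (p | p)
    exacts [hA.U_eq p, hB.U_eq p]

theorem mul [Fintype R] {B : StdAut K M R} {ℓ' : R → RatExp K M} (hA : A.IsLabelling F ℓ)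
    (hB : B.IsLabelling G ℓ') :
    (A.mul B).IsLabelling (.mul F G) (Sum.elim (fun q => .mul (ℓ q) G) ℓ') where
  J_eq := by
    rw [RatExp.differential, ← hA.J_eq, ← hB.J_eq, ← hA.c_eq, mapDomain_pushforward,
      ← pushforward_smul, ← pushforward_sumElim]
    rfl
  F_eq := by
    rintro (p | p)
    · rw [Sum.elim_inl, RatExp.differential, ← hA.F_eq, ← hB.J_eq, ← hA.U_eq,
        mapDomain_pushforward, ← pushforward_smul, ← pushforward_sumElim]
      rfl
    · rw [Sum.elim_inr, ← hB.F_eq, ← zero_add (pushforward ℓ' _),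
        ← pushforward_zero fun q => .mul (ℓ q) G, ← pushforward_sumElim]
      rfl
  c_eq := congrArg₂ (· * ·) hA.c_eq hB.c_eq
  U_eq := by
    rintro (p | p)
    exacts [congrArg₂ (· * ·) (hA.U_eq p) hB.c_eq, hB.U_eq p]

theorem star (h : A.IsLabelling F ℓ) :
    A.star.IsLabelling (.star F) fun q => .mul (ℓ q) (.star F) where
  J_eq := by
    rw [RatExp.differential, ← h.J_eq, ← h.c_eq, mapDomain_pushforward, ← pushforward_smul]
    rfl
  F_eq q := by
    rw [RatExp.differential, RatExp.differential, ← h.F_eq, ← h.J_eq, ← h.c_eq, ← h.U_eq,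
      mapDomain_pushforward, mapDomain_pushforward, ← mul_smul, add_comm, ← pushforward_smul,
      ← pushforward_add]
    rfl
  c_eq := congrArg kstar h.c_eq
  U_eq q := congrArg₂ (· * ·) (h.U_eq q) (congrArg kstar h.c_eq)

theorem reindex [Fintype R] {e : Q ≃ R} {ℓ : R → RatExp K M} (h : A.IsLabelling E (ℓ ∘ e)) :
    (A.reindex e).IsLabelling E ℓ where
  J_eq := (pushforward_comp_equiv_symm e ℓ A.J).trans h.J_eq
  F_eq r := by
    refine (pushforward_comp_equiv_symm e ℓ (A.F (e.symm r))).trans ?_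
    rw [h.F_eq, Function.comp_apply, e.apply_symm_apply]
  c_eq := h.c_eq
  U_eq r := by
    refine (h.U_eq (e.symm r)).trans ?_
    rw [Function.comp_apply, e.apply_symm_apply]

theorem image [Fintype R] {φ : Q → R} {ℓ : R → RatExp K M} (h : A.IsLabelling E (ℓ ∘ φ))
    (hφ : Function.Surjective φ) : (A.image φ hφ).IsLabelling E ℓ where
  J_eq := by
    classical
    have : (A.image φ hφ).J = pushforward φ A.J := by
      ext1 r
      rw [pushforward_apply]
      simp only [StdAut.image]
    rw [this, pushforward_coe_pushforward, h.J_eq]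
  F_eq r := by
    classical
    have : (A.image φ hφ).F r = pushforward φ (A.F (Function.surjInv hφ r)) := by
      ext1 r'
      rw [pushforward_apply]
      simp only [StdAut.image, Matrix.of_apply]
    rw [this, pushforward_coe_pushforward, h.F_eq, Function.comp_apply, Function.surjInv_eq hφ]
  c_eq := h.c_eq
  U_eq r := by
    refine (h.U_eq (Function.surjInv hφ r)).trans ?_
    rw [Function.comp_apply, Function.surjInv_eq hφ]

/-- Linear combinations of distinct expressions are equal only if their coefficients are; hence an
automaton with injective labels is determined by them. -/
theorem isMorphism [Fintype R] {B : StdAut K M R} {φ : Q → R} {ℓ : R → RatExp K M}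
    (hA : A.IsLabelling E (ℓ ∘ φ)) (hB : B.IsLabelling E ℓ) (hℓ : Function.Injective ℓ)
    (hφ : Function.Surjective φ) : Aut.IsMorphism A.toAut B.toAut (Option.map φ) := by
  have descend {f : Q → MonoidAlgebra K M} {g : R → MonoidAlgebra K M}
      (h : pushforward (ℓ ∘ φ) f = pushforward ℓ g) : ⇑(pushforward φ f) = g :=
    coe_pushforward_eq_of_injective hℓ h
  exact isMorphism_toAut hφ (descend (hA.J_eq.trans hB.J_eq.symm))
    (fun p => descend ((hA.F_eq p).trans (hB.F_eq (φ p)).symm))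
    (hA.c_eq.trans hB.c_eq.symm) (funext fun q => (hA.U_eq q).trans (hB.U_eq (φ q)).symm)

end IsLabelling

end StdAut

namespace RatExp

open StdAut

variable {K M : Type*} [Monoid M]

theorem val_comp_addMap (F G : RatExp K M) :
    Subtype.val ∘ addMap F G = Sum.elim Subtype.val Subtype.val := by
  ext (H | H) <;> rfl

theorem val_comp_mulMap (F G : RatExp K M) :
    Subtype.val ∘ mulMap F G = Sum.elim (fun H => mul H.1 G) Subtype.val := by
  ext (H | H) <;> rfl

/-- The derived term that a position of an expression gives rise to. -/
def posMap : ∀ E : RatExp K M, Pos E → ↥(derTer E)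
  | zero => isEmptyElim (α := Empty)
  | one => isEmptyElim (α := Empty)
  | atom _ _ => fun _ => default
  | lmul _ F => posMap F
  | rmul F k => derTerRmulEquiv F k ∘ posMap F
  | add F G => addMap F G ∘ Sum.map (posMap F) (posMap G)
  | mul F G => mulMap F G ∘ Sum.map (posMap F) (posMap G)
  | star F => derTerStarEquiv F ∘ posMap F

theorem posMap_surjective :
    ∀ E : RatExp K M, Function.Surjective (posMap E)
  | zero => isEmptyElim
  | one => isEmptyElim
  | atom _ _ => fun _ => ⟨(), Subsingleton.elim _ _⟩
  | lmul _ F => posMap_surjective F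
  | rmul F k => (derTerRmulEquiv F k).surjective.comp (posMap_surjective F)
  | add F G => (addMap_surjective F G).comp <|
      Sum.map_surjective.2 ⟨posMap_surjective F, posMap_surjective G⟩
  | mul F G => (mulMap_surjective F G).comp <|
      Sum.map_surjective.2 ⟨posMap_surjective F, posMap_surjective G⟩
  | star F => (derTerStarEquiv F).surjective.comp (posMap_surjective F)

variable [Semiring K] [TopologicalSpace K]

theorem isLabelling_term : ∀ E : RatExp K M, (term E).IsLabelling E Subtype.val
  | zero => .const_zero _
  | one => .const_one _
  | atom _ hm => .letter hm rfl
  | lmul k F => (isLabelling_term F).lmul k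
  | rmul F k => ((isLabelling_term F).rmul k).reindex (e := derTerRmulEquiv F k)
  | add F G => .image (by
      rw [val_comp_addMap]; exact (isLabelling_term F).add (isLabelling_term G)) _
  | mul F G => .image (by
      rw [val_comp_mulMap]; exact (isLabelling_term F).mul (isLabelling_term G)) _
  | star F => (isLabelling_term F).star.reindex (e := derTerStarEquiv F)

theorem isLabelling_stan :
    ∀ E : RatExp K M, (stan E).IsLabelling E (Subtype.val ∘ posMap E)
  | zero => .const_zero (Q := Empty) _
  | one => .const_one (Q := Empty) _
  | atom _ hm => .letter (Q := Unit) hm rfl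
  | lmul k F => (isLabelling_stan F).lmul k
  | rmul F k => (isLabelling_stan F).rmul k
  | add F G => by
    rw [show Subtype.val ∘ posMap (add F G) =
      Sum.elim (Subtype.val ∘ posMap F) (Subtype.val ∘ posMap G) by ext (p | p) <;> rfl]
    exact (isLabelling_stan F).add (isLabelling_stan G)
  | mul F G => by
    rw [show Subtype.val ∘ posMap (mul F G) =
      Sum.elim (fun p => mul (posMap F p).1 G) (Subtype.val ∘ posMap G) by ext (p | p) <;> rfl]
    exact (isLabelling_stan F).mul (isLabelling_stan G)
  | star F => (isLabelling_stan F).star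

theorem isMorphism_posMap (E : RatExp K M) :
    Aut.IsMorphism E.stan.toAut E.term.toAut (Option.map (posMap E)) :=
  (isLabelling_stan E).isMorphism (isLabelling_term E) Subtype.val_injective (posMap_surjective E)

theorem isMorphism_addMap (F G : RatExp K M) :
    Aut.IsMorphism (F.term.add G.term).toAut (F.add G).term.toAut (Option.map (addMap F G)) := by
  refine IsLabelling.isMorphism ?_ (isLabelling_term (add F G)) Subtype.val_injective
    (addMap_surjective F G)
  rw [val_comp_addMap]
  exact (isLabelling_term F).add (isLabelling_term G)

theorem isMorphism_mulMap (F G : RatExp K M) :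
    Aut.IsMorphism (F.term.mul G.term).toAut (F.mul G).term.toAut (Option.map (mulMap F G)) := by
  refine IsLabelling.isMorphism ?_ (isLabelling_term (mul F G)) Subtype.val_injective
    (mulMap_surjective F G)
  rw [val_comp_mulMap]
  exact (isLabelling_term F).mul (isLabelling_term G)

end RatExp

section Summation

open Filter Topology

theorem hasSum_iff_tendsto {ι X : Type*} [AddCommMonoid X] [TopologicalSpace X] {f : ι → X}
    {x : X} : HasSum f x ↔ Tendsto (fun s : Finset ι => ∑ i ∈ s, f i) atTop (𝓝 x) := by
  rw [HasSum, SummationFilter.unconditional_filter]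

/-- Grouping along finite fibres needs no regularity of the topology, unlike `HasSum.sigma`. -/
theorem hasSum_sum_of_mem_iff {α β X : Type*} [AddCommMonoid X] [TopologicalSpace X]
    {f : α → X} {x : X} (hf : HasSum f x) (π : α → β) (fiber : β → Finset α)
    (mem_fiber : ∀ a b, a ∈ fiber b ↔ π a = b) : HasSum (fun b => ∑ a ∈ fiber b, f a) x := by
  classical
  have disjoint_fiber (s : Finset β) : (s : Set β).PairwiseDisjoint fiber := by
    intro b _ b' _ hbb'
    refine Finset.disjoint_left.2 fun a ha ha' => hbb' ?_
    rw [← (mem_fiber a b).1 ha, (mem_fiber a b').1 ha']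
  have biUnion_fiber : Tendsto (fun s : Finset β => s.biUnion fiber) atTop atTop :=
    tendsto_atTop_finset_of_monotone (fun _ _ h => Finset.biUnion_subset_biUnion_of_subset_left _ h)
      fun a => ⟨{π a}, by simp [mem_fiber]⟩
  exact hasSum_iff_tendsto.2 <| ((hasSum_iff_tendsto.1 hf).comp biUnion_fiber).congr fun s =>
    Finset.sum_biUnion (disjoint_fiber s)

namespace IsStrong

variable {K : Type*} [Semiring K] [TopologicalSpace K] [IsTopologicalSemiring K] [T2Space K]

theorem hasSum_mul (hK : IsStrong K) {ι κ : Type} {f : ι → K} {g : κ → K} {a b : K}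
    (hf : HasSum f a) (hg : HasSum g b) : HasSum (fun p : ι × κ => f p.1 * g p.2) (a * b) := by
  classical
  obtain ⟨c, hc⟩ := hK ι κ f g hf.summable hg.summable
  have hc' : Tendsto (fun p : Finset ι × Finset κ => (∑ i ∈ p.1, f i) * ∑ j ∈ p.2, g j)
      atTop (𝓝 c) :=
    ((hasSum_iff_tendsto.1 hc).comp tendsto_finsetProd_atTop).congr fun p => by
      simp only [Function.comp_apply, Finset.sum_mul_sum, Finset.sum_product]
  have hab : Tendsto (fun p : Finset ι × Finset κ => (∑ i ∈ p.1, f i) * ∑ j ∈ p.2, g j)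
      atTop (𝓝 (a * b)) := by
    rw [← prod_atTop_atTop_eq]
    exact ((hasSum_iff_tendsto.1 hf).comp tendsto_fst).mul
      ((hasSum_iff_tendsto.1 hg).comp tendsto_snd)
  exact tendsto_nhds_unique hc' hab ▸ hc

theorem hasSum_antidiagonal (hK : IsStrong K) {f g : ℕ → K} {a b : K}
    (hf : HasSum f a) (hg : HasSum g b) :
    HasSum (fun n => ∑ p ∈ Finset.HasAntidiagonal.antidiagonal n, f p.1 * g p.2) (a * b) :=
  hasSum_sum_of_mem_iff (hK.hasSum_mul hf hg) (fun p => p.1 + p.2) _ fun _ _ =>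
    Finset.HasAntidiagonal.mem_antidiagonal

theorem hasSum_of_recursion (hK : IsStrong K) {k : K} (hk : Starrable k) {a b : ℕ → K}
    {B : K} (hb : HasSum b B) (hab : ∀ n, a (n + 1) = k * a n + b n) :
    HasSum a (kstar k * (a 0 + B)) := by
  let c : ℕ → K
    | 0 => a 0
    | n + 1 => b n
  have hc : HasSum c (a 0 + B) := HasSum.zero_add (f := c) hb
  have ha (n : ℕ) : ∑ p ∈ Finset.HasAntidiagonal.antidiagonal n, k ^ p.1 * c p.2 = a n := by
    induction n with
    | zero => simp [c]
    | succ n ih =>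
      rw [hab, ← ih, Finset.Nat.sum_antidiagonal_succ, Finset.mul_sum, add_comm]
      simp [c, pow_succ', mul_assoc]
  have := hK.hasSum_antidiagonal hk.hasSum hc
  simpa only [ha, kstar] using this

end IsStrong

end Summation

theorem IsGraded.mul_eq_one_iff {M : Type*} [Monoid M] (hM : IsGraded M) {x y : M} :
    x * y = 1 ↔ x = 1 ∧ y = 1 := by
  obtain ⟨len, len_mul, len_eq_zero⟩ := hM
  rw [← len_eq_zero, len_mul, Nat.add_eq_zero_iff, len_eq_zero, len_eq_zero]

open Finset.HasMulAntidiagonal (mulAntidiagonal mem_mulAntidiagonal)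

/-- The semiring of formal power series over a monoid in which every element has finitely many
factorisations. It is a synonym of `Series K N`, which has the pointwise product as a function
type. -/
def CauchySeries (K N : Type*) : Type _ := N → K

namespace CauchySeries

variable {K N : Type*}

@[ext]
theorem ext {s t : CauchySeries K N} (h : ∀ m, s m = t m) : s = t := funext h

variable [Semiring K]

instance : AddCommMonoid (CauchySeries K N) := inferInstanceAs (AddCommMonoid (N → K))

@[simp]
theorem zero_apply (m : N) : (0 : CauchySeries K N) m = 0 := rfl

@[simp]
theorem add_apply (s t : CauchySeries K N) (m : N) : (s + t) m = s m + t m := rfl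

@[simp]
theorem sum_apply {ι : Type*} (F : Finset ι) (s : ι → CauchySeries K N) (m : N) :
    (∑ i ∈ F, s i) m = ∑ i ∈ F, s i m := Finset.sum_apply m F s

variable [Monoid N]

open Classical in
/-- The constant series. -/
def const (k : K) : CauchySeries K N := fun m => if m = 1 then k else 0

variable [Finset.HasMulAntidiagonal N]

instance : Mul (CauchySeries K N) where
  mul s t m := ∑ p ∈ mulAntidiagonal m, s p.1 * t p.2

theorem mul_apply (s t : CauchySeries K N) (m : N) :
    (s * t) m = ∑ p ∈ mulAntidiagonal m, s p.1 * t p.2 := rfl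

@[simp]
theorem const_mul_apply (k : K) (s : CauchySeries K N) (m : N) :
    (const k * s : CauchySeries K N) m = k * s m := by
  rw [mul_apply, Finset.sum_eq_single (1, m)]
  · simp [const]
  · rintro ⟨x, y⟩ hxy hne
    have : x ≠ 1 := by rintro rfl; simp_all
    simp [const, this]
  · simp

@[simp]
theorem mul_const_apply (s : CauchySeries K N) (k : K) (m : N) :
    (s * const k : CauchySeries K N) m = s m * k := by
  rw [mul_apply, Finset.sum_eq_single (m, 1)]
  · simp [const]
  · rintro ⟨x, y⟩ hxy hne
    have : y ≠ 1 := by rintro rfl; simp_all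
    simp [const, this]
  · simp

protected theorem mul_assoc (s t r : CauchySeries K N) : s * t * r = s * (t * r) := by
  ext m
  simp only [mul_apply, Finset.sum_mul, Finset.mul_sum, Finset.sum_sigma']
  refine Finset.sum_nbij' (fun ⟨⟨_, z⟩, ⟨x, y⟩⟩ => ⟨(x, y * z), (y, z)⟩)
    (fun ⟨⟨x, _⟩, ⟨y, z⟩⟩ => ⟨(x * y, z), (x, y)⟩) ?_ ?_ ?_ ?_ ?_
  · rintro ⟨⟨w, z⟩, x, y⟩ h
    simp only [Finset.mem_sigma, mem_mulAntidiagonal] at h ⊢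
    simp [← h.1, ← h.2, mul_assoc]
  · rintro ⟨⟨x, w⟩, y, z⟩ h
    simp only [Finset.mem_sigma, mem_mulAntidiagonal] at h ⊢
    simp [← h.1, ← h.2, mul_assoc]
  · rintro ⟨⟨w, z⟩, x, y⟩ h
    simp_all
  · rintro ⟨⟨x, w⟩, y, z⟩ h
    simp_all
  · simp [_root_.mul_assoc]

instance : Semiring (CauchySeries K N) where
  one := const 1
  zero_mul s := by ext m; simp [mul_apply]
  mul_zero s := by ext m; simp [mul_apply]
  left_distrib s t r := by ext m; simp [mul_apply, mul_add, Finset.sum_add_distrib]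
  right_distrib s t r := by ext m; simp [mul_apply, add_mul, Finset.sum_add_distrib]
  mul_assoc := CauchySeries.mul_assoc
  one_mul s := by ext m; exact (const_mul_apply 1 s m).trans (one_mul _)
  mul_one s := by ext m; exact (mul_const_apply s 1 m).trans (mul_one _)

/-- The inclusion of the coefficients as the constant series. -/
def C : K →+* CauchySeries K N where
  toFun := const
  map_zero' := by ext m; simp [const]
  map_one' := rfl
  map_add' a b := by ext m; by_cases hm : m = 1 <;> simp [const, hm]
  map_mul' a b := by ext m; by_cases hm : m = 1 <;> simp [const, hm]

@[simp]
theorem C_mul_apply (k : K) (s : CauchySeries K N) (m : N) :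
    (C k * s : CauchySeries K N) m = k * s m :=
  const_mul_apply k s m

@[simp]
theorem mul_C_apply (s : CauchySeries K N) (k : K) (m : N) :
    (s * C k : CauchySeries K N) m = s m * k :=
  mul_const_apply s k m

theorem mul_apply_one (hN : IsGraded N) (s t : CauchySeries K N) : (s * t) 1 = s 1 * t 1 := by
  have : mulAntidiagonal (1 : N) = {(1, 1)} := by
    ext ⟨x, y⟩
    simp only [mem_mulAntidiagonal, hN.mul_eq_one_iff, Finset.mem_singleton, Prod.mk.injEq]
  rw [mul_apply, this, Finset.sum_singleton]

section Star

variable [TopologicalSpace K] [IsTopologicalSemiring K] [T2Space K]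

/-- The star of a series, as a pointwise sum; a junk value unless its powers are summable. -/
def star (s : CauchySeries K N) : CauchySeries K N := fun m => ∑' n : ℕ, (s ^ n) m

/-- As `t` has no constant term, the coefficient of `t * s ^ n` at `m` only involves coefficients of
`s ^ n` at shorter elements, which allows for an induction on the length. -/
theorem hasSum_pow_and_star_apply (hK : IsStrong K) (hN : IsGraded N) {c : K} (hc : Starrable c)
    {s t : CauchySeries K N} (hs : s = C c + t) (ht : t 1 = 0) (m : N) :
    HasSum (fun n : ℕ => (s ^ n) m) ((C (kstar c) * (1 + t * star s) : CauchySeries K N) m) := by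
  obtain ⟨len, len_mul, len_eq_zero⟩ := hN
  induction hm : len m using Nat.strong_induction_on generalizing m with | _ l ih
  have hasSum_tail : HasSum (fun n : ℕ => (t * s ^ n) m) ((t * star s) m) := by
    refine hasSum_sum fun p hp => ?_
    by_cases hp1 : p.1 = 1
    · simpa only [hp1, ht, zero_mul] using hasSum_zero
    · have := len_mul p.1 p.2
      rw [mem_mulAntidiagonal.1 hp, hm] at this
      have hlt : len p.2 < l := by
        have := mt (len_eq_zero p.1).1 hp1
        lia
      exact (ih _ hlt p.2 rfl).summable.hasSum.mul_left _
  rw [C_mul_apply]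
  refine hK.hasSum_of_recursion hc hasSum_tail fun n => ?_
  rw [pow_succ', ← C_mul_apply, ← add_apply, ← add_mul, ← hs]

theorem star_eq (hK : IsStrong K) (hN : IsGraded N) {c : K} (hc : Starrable c)
    {s t : CauchySeries K N} (hs : s = C c + t) (ht : t 1 = 0) :
    star s = C (kstar c) * (1 + t * star s) :=
  ext fun m => (hasSum_pow_and_star_apply hK hN hc hs ht m).tsum_eq

theorem hasSum_pow (hK : IsStrong K) (hN : IsGraded N) {c : K} (hc : Starrable c)
    {s t : CauchySeries K N} (hs : s = C c + t) (ht : t 1 = 0) (m : N) :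
    HasSum (fun n : ℕ => (s ^ n) m) (star s m) :=
  (hasSum_pow_and_star_apply hK hN hc hs ht m).summable.hasSum

end Star

end CauchySeries

section Submonoid

variable {M : Type*} [Monoid M]

theorem IsGraded.submonoid (hM : IsGraded M) (N : Submonoid M) : IsGraded N := by
  obtain ⟨len, len_mul, len_eq_zero⟩ := hM
  refine ⟨fun x => len x, fun x y => len_mul x y, fun x => ?_⟩
  rw [len_eq_zero, OneMemClass.coe_eq_one]

theorem finite_setOf_mem_closure_and_length_le {len : M → ℕ}
    (len_mul : ∀ x y, len (x * y) = len x + len y) {A : Set M} (hA : A.Finite)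
    (len_ne_zero : ∀ a ∈ A, len a ≠ 0) (n : ℕ) :
    {x | x ∈ Submonoid.closure A ∧ len x ≤ n}.Finite := by
  induction n with
  | zero =>
    refine (Set.finite_singleton 1).subset ?_
    rintro x ⟨hx, hxn⟩
    induction hx using Submonoid.closure_induction_left with
    | one => rfl
    | mul_left a ha y _ _ => grind
  | succ n ih =>
    refine ((Set.finite_singleton 1).union (hA.image2 (· * ·) ih)).subset ?_
    rintro x ⟨hx, hxn⟩
    induction hx using Submonoid.closure_induction_left with
    | one => exact Or.inl rfl
    | mul_left a ha y hy _ => exact Or.inr ⟨a, ha, y, ⟨hy, by grind⟩, rfl⟩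

theorem IsGraded.nonempty_hasMulAntidiagonal_closure (hM : IsGraded M) {A : Set M}
    (hA : A.Finite) (one_notMem : 1 ∉ A) :
    Nonempty (Finset.HasMulAntidiagonal (Submonoid.closure A)) := by
  obtain ⟨len, len_mul, len_eq_zero⟩ := hM
  have finite_le (n : ℕ) : {x : Submonoid.closure A | len x ≤ n}.Finite := by
    refine Set.Finite.of_finite_image (f := Subtype.val) ?_ Subtype.val_injective.injOn
    refine (finite_setOf_mem_closure_and_length_le len_mul hA ?_ n).subset ?_
    · exact fun a ha h => one_notMem ((len_eq_zero a).1 h ▸ ha)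
    · rintro _ ⟨x, hx, rfl⟩
      exact ⟨x.2, hx⟩
  have finite_factorisations (m : Submonoid.closure A) :
      {p : Submonoid.closure A × Submonoid.closure A | p.1 * p.2 = m}.Finite := by
    refine ((finite_le (len m)).prod (finite_le (len m))).subset ?_
    rintro ⟨x, y⟩ rfl
    simp [len_mul]
  exact ⟨⟨fun m => (finite_factorisations m).toFinset, by simp⟩⟩

end Submonoid

theorem series_mul_apply {K M : Type*} [Semiring K] [Monoid M] {s t : Series K M} {m : M}
    {F : Finset (M × M)} (mem_F : ∀ p : M × M, s p.1 * t p.2 ≠ 0 → (p.1 * p.2 = m ↔ p ∈ F)) :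
    Series.mul s t m = ∑ p ∈ F, s p.1 * t p.2 :=
  (finsum_set_coe_eq_finsum_mem (f := fun p : M × M => s p.1 * t p.2)
    {p : M × M | p.1 * p.2 = m}).trans <|
    finsum_mem_eq_sum_of_inter_support_eq _ <| Set.ext fun p => and_congr_left (mem_F p)

theorem coeff_single_eq_monomial {K M : Type*} [Semiring K] (m : M) (k : K) :
    ((MonoidAlgebra.single m k).coeff : Series K M) = Series.monomial m k := by
  classical
  ext x
  rw [MonoidAlgebra.coeff_single, Finsupp.single_apply, Series.monomial]
  simp only [eq_comm]

theorem coeff_mul_eq_series_mul {K M : Type*} [Semiring K] [Monoid M] (x y : MonoidAlgebra K M) :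
    ((x * y).coeff : Series K M) = Series.mul x.coeff y.coeff := by
  classical
  ext m
  rw [series_mul_apply (F := {p ∈ x.coeff.support ×ˢ y.coeff.support | p.1 * p.2 = m}),
    MonoidAlgebra.coeff_mul, Finset.sum_filter, Finset.sum_product]
  · rfl
  · intro p hp
    simp [left_ne_zero_of_mul hp, right_ne_zero_of_mul hp]

namespace CauchySeries

open Finset.HasMulAntidiagonal (mulAntidiagonal mem_mulAntidiagonal)

variable {K M : Type*} [Semiring K] [Monoid M] {N : Submonoid M}

/-- Extension of a series over a submonoid by zero. -/
def toSeries (s : CauchySeries K N) : Series K M := Function.extend (γ := K) Subtype.val s 0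

@[simp]
theorem toSeries_coe (s : CauchySeries K N) (m : N) : s.toSeries m = s m :=
  Subtype.val_injective.extend_apply s 0 m

theorem toSeries_of_notMem (s : CauchySeries K N) {m : M} (hm : m ∉ N) : s.toSeries m = 0 :=
  Function.extend_apply' s (0 : M → K) m fun ⟨x, hx⟩ => hm (hx ▸ x.2)

theorem mem_of_toSeries_ne_zero {s : CauchySeries K N} {m : M} (hm : s.toSeries m ≠ 0) : m ∈ N :=
  by_contra fun h => hm (s.toSeries_of_notMem h)

theorem eq_toSeries {f : Series K M} {s : CauchySeries K N} (hf : ∀ m ∉ N, f m = 0)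
    (h : ∀ m : N, f m = s m) : f = s.toSeries := by
  ext m
  by_cases hm : m ∈ N
  · exact (h ⟨m, hm⟩).trans (s.toSeries_coe ⟨m, hm⟩).symm
  · rw [hf m hm, toSeries_of_notMem s hm]

theorem toSeries_zero : toSeries (0 : CauchySeries K N) = 0 :=
  (eq_toSeries (fun _ _ => rfl) fun _ => rfl).symm

theorem toSeries_add (s t : CauchySeries K N) : toSeries (s + t) = s.toSeries + t.toSeries :=
  (eq_toSeries (fun m hm => by simp [toSeries_of_notMem, hm]) fun m => by simp).symm

theorem toSeries_sum {ι : Type*} (F : Finset ι) (s : ι → CauchySeries K N) :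
    toSeries (∑ i ∈ F, s i) = ∑ i ∈ F, (s i).toSeries :=
  map_sum (⟨⟨toSeries, toSeries_zero⟩, toSeries_add⟩ : CauchySeries K N →+ Series K M) s F

theorem hasSum_toSeries [TopologicalSpace K] {ι : Type*} {f : ι → CauchySeries K N}
    {s : CauchySeries K N} (h : ∀ m, HasSum (fun i => f i m) (s m)) :
    HasSum (fun i => (f i).toSeries) s.toSeries := by
  refine Pi.hasSum.2 fun m => ?_
  by_cases hm : m ∈ N
  · simpa only [← toSeries_coe] using h ⟨m, hm⟩
  · simpa only [toSeries_of_notMem _ hm] using hasSum_zero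

/-- The restriction to a submonoid of the series defined by an element of the monoid algebra. -/
def restrict (N : Submonoid M) : MonoidAlgebra K M →+ CauchySeries K N where
  toFun x := fun m => x.coeff m
  map_zero' := rfl
  map_add' _ _ := rfl

theorem restrict_apply (x : MonoidAlgebra K M) (m : N) : restrict N x m = x.coeff m := rfl

variable [Finset.HasMulAntidiagonal N]

theorem monomial_one (k : K) : Series.monomial 1 k = toSeries (C k : CauchySeries K N) := by
  refine eq_toSeries (fun m hm => if_neg ?_) fun m => ?_
  · rintro rfl
    exact hm N.one_mem
  · by_cases hm : m = 1 <;> simp [Series.monomial, C, const, hm]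

theorem toSeries_C_mul (k : K) (s : CauchySeries K N) :
    toSeries (C k * s) = fun m => k * s.toSeries m :=
  (eq_toSeries (fun m hm => by simp [toSeries_of_notMem, hm]) fun m => by simp).symm

theorem toSeries_mul_C (s : CauchySeries K N) (k : K) :
    toSeries (s * C k) = fun m => s.toSeries m * k :=
  (eq_toSeries (fun m hm => by simp [toSeries_of_notMem, hm]) fun m => by simp).symm

theorem mulDefined_toSeries (s t : CauchySeries K N) :
    Series.MulDefined s.toSeries t.toSeries := by
  intro m
  by_cases hm : m ∈ N
  · refine ((mulAntidiagonal (⟨m, hm⟩ : N)).finite_toSet.image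
      (Prod.map Subtype.val Subtype.val)).subset ?_
    rintro ⟨x, y⟩ ⟨hxy, hx, hy⟩
    exact ⟨(⟨x, mem_of_toSeries_ne_zero hx⟩, ⟨y, mem_of_toSeries_ne_zero hy⟩),
      mem_mulAntidiagonal.2 (Subtype.ext hxy), rfl⟩
  · refine Set.finite_empty.subset ?_
    rintro ⟨x, y⟩ ⟨rfl, hx, hy⟩
    exact hm (N.mul_mem (mem_of_toSeries_ne_zero hx) (mem_of_toSeries_ne_zero hy))

theorem series_mul_toSeries (s t : CauchySeries K N) :
    Series.mul s.toSeries t.toSeries = toSeries (s * t) := by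
  have factors_mem {p : M × M} (hp : s.toSeries p.1 * t.toSeries p.2 ≠ 0) : p.1 ∈ N ∧ p.2 ∈ N :=
    ⟨mem_of_toSeries_ne_zero (left_ne_zero_of_mul hp),
      mem_of_toSeries_ne_zero (right_ne_zero_of_mul hp)⟩
  refine eq_toSeries (fun m hm => finsum_eq_zero_of_forall_eq_zero fun p => ?_) fun m => ?_
  · by_contra hp
    exact hm (p.2 ▸ N.mul_mem (factors_mem hp).1 (factors_mem hp).2)
  · let e : N × N ↪ M × M := .prodMap (.subtype _) (.subtype _)
    rw [series_mul_apply (F := (mulAntidiagonal m).map e), Finset.sum_map, mul_apply]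
    · simp [e]
    · intro p hp
      simp only [Finset.mem_map, mem_mulAntidiagonal]
      refine ⟨fun h => ?_, ?_⟩
      · exact ⟨(⟨p.1, (factors_mem hp).1⟩, ⟨p.2, (factors_mem hp).2⟩), Subtype.ext h, rfl⟩
      · rintro ⟨q, rfl, rfl⟩
        rfl

theorem series_pow_toSeries (s : CauchySeries K N) (n : ℕ) :
    Series.pow s.toSeries n = toSeries (s ^ n) := by
  induction n with
  | zero => rw [Series.pow, monomial_one (N := N), map_one, pow_zero]
  | succ n ih => rw [Series.pow, ih, series_mul_toSeries, pow_succ]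

section Star

variable [TopologicalSpace K]

theorem starDefined_toSeries {s t : CauchySeries K N}
    (h : ∀ m, HasSum (fun n : ℕ => (s ^ n) m) (t m)) : Series.StarDefined s.toSeries := by
  simp only [Series.StarDefined, series_pow_toSeries]
  exact ⟨fun n => mulDefined_toSeries _ _, (hasSum_toSeries h).summable⟩

theorem series_star_toSeries [T2Space K] {s t : CauchySeries K N}
    (h : ∀ m, HasSum (fun n : ℕ => (s ^ n) m) (t m)) :
    Series.star s.toSeries = t.toSeries := by
  simp only [Series.star, series_pow_toSeries]
  exact (hasSum_toSeries h).tsum_eq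

end Star

theorem restrict_smul (k : K) (x : MonoidAlgebra K M) :
    restrict N (k • x) = C k * restrict N x := by
  ext m
  rw [C_mul_apply]
  rfl

end CauchySeries

namespace RatExp

open CauchySeries

variable {K M : Type*} [Monoid M]

/-- The set of atoms that occur in an expression. -/
def atoms : RatExp K M → Set M
  | zero => ∅
  | one => ∅
  | atom m _ => {m}
  | lmul _ F => atoms F
  | rmul F _ => atoms F
  | add F G => atoms F ∪ atoms G
  | mul F G => atoms F ∪ atoms G
  | star F => atoms F

theorem finite_atoms (E : RatExp K M) : E.atoms.Finite := by
  induction E with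
  | zero | one => exact Set.finite_empty
  | atom m _ => exact Set.finite_singleton m
  | lmul _ _ ih | rmul _ _ ih | star _ ih => exact ih
  | add _ _ ihF ihG | mul _ _ ihF ihG => exact ihF.union ihG

theorem one_notMem_atoms (E : RatExp K M) : 1 ∉ E.atoms := by
  induction E with
  | zero | one => exact Set.notMem_empty 1
  | atom _ hm => exact hm.symm
  | lmul _ _ ih | rmul _ _ ih | star _ ih => exact ih
  | add _ _ ihF ihG | mul _ _ ihF ihG => exact fun h => h.elim ihF ihG

variable [Semiring K] [TopologicalSpace K]

theorem Valid.of_mem_derTer {E H : RatExp K M} (hE : E.Valid)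
    (hH : H ∈ derTer E) : H.Valid := by
  classical
  induction E generalizing H with
  | zero | one => exact absurd hH (Finset.notMem_empty H)
  | atom m hm => exact Finset.mem_singleton.1 hH ▸ trivial
  | lmul k F ih => exact ih hE hH
  | rmul F k ih =>
    obtain ⟨H', hH', rfl⟩ := Finset.mem_image.1 hH
    exact (ih hE hH' :)
  | add F G ihF ihG =>
    exact (Finset.mem_union.1 hH).elim (ihF hE.1) (ihG hE.2)
  | mul F G ihF ihG =>
    rcases Finset.mem_union.1 hH with hH | hH
    · obtain ⟨H', hH', rfl⟩ := Finset.mem_image.1 hH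
      exact ⟨ihF hE.1 hH', hE.2⟩
    · exact ihG hE.2 hH
  | star F ih =>
    obtain ⟨H', hH', rfl⟩ := Finset.mem_image.1 hH
    exact ⟨ih hE.1 hH', hE⟩

variable (N : Submonoid M) [Finset.HasMulAntidiagonal N]

/-- The series denoted by an expression, restricted to `N` and computed in `CauchySeries K N`. It is
the restriction of `series` if all the atoms are in `N`. -/
def seriesOn : RatExp K M → CauchySeries K N
  | zero => 0
  | one => 1
  | atom m _ => restrict N (MonoidAlgebra.single m 1)
  | lmul k F => C k * seriesOn F
  | rmul F k => seriesOn F * C k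
  | add F G => seriesOn F + seriesOn G
  | mul F G => seriesOn F * seriesOn G
  | star F => CauchySeries.star (seriesOn F)

/-- The series denoted by a linear combination of expressions, such as a differential. -/
def sumSeriesOn : (RatExp K M →₀ MonoidAlgebra K M) →+ CauchySeries K N :=
  Finsupp.liftAddHom fun H => (AddMonoidHom.mulRight (seriesOn N H)).comp (restrict N)

theorem sumSeriesOn_single (H : RatExp K M) (x : MonoidAlgebra K M) :
    sumSeriesOn N (Finsupp.single H x) = restrict N x * seriesOn N H :=
  Finsupp.liftAddHom_apply_single _ H x

theorem sumSeriesOn_smul (k : K) (D : RatExp K M →₀ MonoidAlgebra K M) :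
    sumSeriesOn N (k • D) = C k * sumSeriesOn N D := by
  induction D using Finsupp.induction_linear with
  | zero => simp only [smul_zero, map_zero, mul_zero]
  | add D D' ih ih' => rw [smul_add, map_add, map_add, mul_add, ih, ih']
  | single H x =>
    rw [Finsupp.smul_single, sumSeriesOn_single, sumSeriesOn_single, restrict_smul, mul_assoc]

variable {N} in
theorem sumSeriesOn_mapDomain {φ : RatExp K M → RatExp K M} {t : CauchySeries K N}
    (hφ : ∀ H, seriesOn N (φ H) = seriesOn N H * t) (D : RatExp K M →₀ MonoidAlgebra K M) :
    sumSeriesOn N (D.mapDomain φ) = sumSeriesOn N D * t := by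
  induction D using Finsupp.induction_linear with
  | zero => simp only [Finsupp.mapDomain_zero, map_zero, zero_mul]
  | add D D' ih ih' => rw [Finsupp.mapDomain_add, map_add, map_add, add_mul, ih, ih']
  | single H x =>
    rw [Finsupp.mapDomain_single, sumSeriesOn_single, sumSeriesOn_single, hφ, mul_assoc]

theorem sumSeriesOn_pushforward {Q : Type*} [Fintype Q] (ℓ : Q → RatExp K M)
    (f : Q → MonoidAlgebra K M) :
    sumSeriesOn N (pushforward ℓ f) = ∑ q, restrict N (f q) * seriesOn N (ℓ q) := by
  simp only [pushforward, map_sum, sumSeriesOn_single]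

theorem sumSeriesOn_differential_apply_one (hM : IsGraded M) (E : RatExp K M) :
    sumSeriesOn N (differential E) 1 = 0 := by
  rw [← (isLabelling_term E).J_eq, sumSeriesOn_pushforward, CauchySeries.sum_apply]
  refine Finset.sum_eq_zero fun H _ => ?_
  rw [mul_apply_one (hM.submonoid N), restrict_apply, OneMemClass.coe_one, E.term.J_proper,
    zero_mul]

variable [IsTopologicalSemiring K] [T2Space K]

theorem seriesOn_eq (hK : IsStrong K) (hM : IsGraded M) {E : RatExp K M} (hE : E.Valid) :
    seriesOn N E = C E.constTerm + sumSeriesOn N (differential E) := by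
  induction E with
  | zero => simp only [seriesOn, constTerm, differential, map_zero, add_zero]
  | one => simp only [seriesOn, constTerm, differential, map_zero, map_one, add_zero]
  | atom m hm =>
    rw [constTerm, differential, sumSeriesOn_single, seriesOn, seriesOn, mul_one, map_zero,
      zero_add]
  | lmul k F ih =>
    rw [constTerm, differential, sumSeriesOn_smul, map_mul, ← mul_add, ← ih hE, seriesOn]
  | rmul F k ih =>
    rw [constTerm, differential, sumSeriesOn_mapDomain (t := C k) fun _ => rfl, map_mul,
      ← add_mul, ← ih hE, seriesOn]
  | add F G ihF ihG =>
    rw [constTerm, differential, map_add, map_add, add_add_add_comm, ← ihF hE.1, ← ihG hE.2,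
      seriesOn]
  | mul F G ihF ihG =>
    calc seriesOn N F * seriesOn N G
        = C F.constTerm * (C G.constTerm + sumSeriesOn N (differential G)) +
            sumSeriesOn N (differential F) * seriesOn N G := by
          rw [← ihG hE.2, ← add_mul, ← ihF hE.1]
      _ = _ := by
          rw [constTerm, differential, map_add, sumSeriesOn_mapDomain fun _ => rfl,
            sumSeriesOn_smul, map_mul, mul_add, add_assoc, add_comm (_ * seriesOn N G)]
  | star F ih =>
    calc seriesOn N (star F)
        = C (kstar F.constTerm) * (1 + sumSeriesOn N (differential F) * seriesOn N (star F)) :=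
          star_eq hK (hM.submonoid N) hE.2 (ih hE.1) (sumSeriesOn_differential_apply_one N hM F)
      _ = _ := by
          rw [constTerm, differential, sumSeriesOn_smul, sumSeriesOn_mapDomain fun _ => rfl,
            mul_add, mul_one]

theorem hasSum_seriesOn_pow (hK : IsStrong K) (hM : IsGraded M) {F : RatExp K M}
    (hF : F.star.Valid) (m : N) :
    HasSum (fun n : ℕ => (seriesOn N F ^ n) m) (seriesOn N F.star m) :=
  hasSum_pow hK (hM.submonoid N) hF.2 (seriesOn_eq N hK hM hF.1)
    (sumSeriesOn_differential_apply_one N hM F) m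

variable {N} in
theorem seriesDefined_and_series_eq (hK : IsStrong K) (hM : IsGraded M) {E : RatExp K M}
    (hE : E.Valid) (hN : E.atoms ⊆ N) : E.SeriesDefined ∧ E.series = (seriesOn N E).toSeries := by
  induction E with
  | zero => exact ⟨trivial, toSeries_zero.symm⟩
  | one => exact ⟨trivial, (monomial_one (N := N) 1).trans (by rw [map_one, seriesOn])⟩
  | atom m hm =>
    refine ⟨trivial, eq_toSeries (fun x hx => if_neg ?_) fun x => ?_⟩
    · rintro rfl
      exact hx (hN rfl)
    · exact (congrFun (coeff_single_eq_monomial m 1) x).symm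
  | lmul k F ih =>
    obtain ⟨defined, eq⟩ := ih hE hN
    exact ⟨defined, by rw [series, eq, seriesOn, toSeries_C_mul]⟩
  | rmul F k ih =>
    obtain ⟨defined, eq⟩ := ih hE hN
    exact ⟨defined, by rw [series, eq, seriesOn, toSeries_mul_C]⟩
  | add F G ihF ihG =>
    obtain ⟨definedF, eqF⟩ := ihF hE.1 (Set.union_subset_iff.1 hN).1
    obtain ⟨definedG, eqG⟩ := ihG hE.2 (Set.union_subset_iff.1 hN).2
    exact ⟨⟨definedF, definedG⟩, by rw [series, eqF, eqG, seriesOn, toSeries_add]; rfl⟩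
  | mul F G ihF ihG =>
    obtain ⟨definedF, eqF⟩ := ihF hE.1 (Set.union_subset_iff.1 hN).1
    obtain ⟨definedG, eqG⟩ := ihG hE.2 (Set.union_subset_iff.1 hN).2
    rw [SeriesDefined, series, eqF, eqG, seriesOn, series_mul_toSeries]
    exact ⟨⟨definedF, definedG, mulDefined_toSeries _ _⟩, rfl⟩
  | star F ih =>
    obtain ⟨defined, eq⟩ := ih hE.1 hN
    rw [SeriesDefined, series, eq]
    exact ⟨⟨defined, starDefined_toSeries (hasSum_seriesOn_pow N hK hM hE)⟩,
      series_star_toSeries (hasSum_seriesOn_pow N hK hM hE)⟩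

end RatExp

theorem eq_sum_pow_mulVec_add {Q S : Type*} [Fintype Q] [DecidableEq Q] [Semiring S]
    {G : Matrix Q Q S} {b v : Q → S} (h : v = b + G.mulVec v) (n : ℕ) :
    v = ∑ i ∈ Finset.range n, (G ^ i).mulVec b + (G ^ n).mulVec v := by
  induction n with
  | zero => rw [Finset.sum_range_zero, pow_zero, Matrix.one_mulVec, zero_add]
  | succ n ih =>
    nth_rw 2 [h] at ih
    rw [Finset.sum_range_succ, pow_succ, ← Matrix.mulVec_mulVec, add_assoc, ← Matrix.mulVec_add]
    exact ih

namespace CauchySeries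

section Order

variable {K N Q : Type*} [Semiring K] [Monoid N] [Finset.HasMulAntidiagonal N] {len : N → ℕ}

theorem mul_apply_eq_zero_of_length_lt (len_mul : ∀ x y, len (x * y) = len x + len y)
    {s t : CauchySeries K N} {a b : ℕ} (hs : ∀ m, len m < a → s m = 0)
    (ht : ∀ m, len m < b → t m = 0) {m : N} (hm : len m < a + b) :
    (s * t : CauchySeries K N) m = 0 := by
  refine Finset.sum_eq_zero fun p hp => ?_
  rw [← Finset.HasMulAntidiagonal.mem_mulAntidiagonal.1 hp, len_mul] at hm
  rcases lt_or_ge (len p.1) a with h | h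
  · rw [hs _ h, zero_mul]
  · rw [ht p.2 (by lia), mul_zero]

theorem pow_apply_eq_zero_of_length_lt [Fintype Q] [DecidableEq Q]
    (len_mul : ∀ x y, len (x * y) = len x + len y) (len_eq_zero : ∀ x, len x = 0 ↔ x = 1)
    {G : Matrix Q Q (CauchySeries K N)} (hG : ∀ p q, G p q 1 = 0) (n : ℕ) (p q : Q) (m : N)
    (hm : len m < n) : (G ^ n) p q m = 0 := by
  induction n generalizing p q m with
  | zero => exact absurd hm (Nat.not_lt_zero _)
  | succ n ih =>
    rw [pow_succ, Matrix.mul_apply, CauchySeries.sum_apply]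
    refine Finset.sum_eq_zero fun r _ =>
      mul_apply_eq_zero_of_length_lt len_mul (ih p r) (fun x hx => ?_) hm
    rw [(len_eq_zero x).1 (Nat.lt_one_iff.1 hx), hG]

end Order

end CauchySeries

namespace Aut

open CauchySeries

variable {K M Q : Type*} [Semiring K] [Monoid M] [Fintype Q] {N : Submonoid M}
  [Finset.HasMulAntidiagonal N]

theorem coeff_pow_eq_toSeries [DecidableEq Q] {E : Matrix Q Q (MonoidAlgebra K M)}
    {G : Matrix Q Q (CauchySeries K N)} (hG : ∀ p q, (E p q).coeff = (G p q).toSeries) (n : ℕ)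
    (p q : Q) : ((E ^ n) p q).coeff = ((G ^ n) p q).toSeries := by
  induction n generalizing p q with
  | zero =>
    rw [pow_zero, pow_zero, Matrix.one_apply, Matrix.one_apply]
    split_ifs
    · rw [← map_one (C : K →+* CauchySeries K N), ← monomial_one]
      exact coeff_single_eq_monomial 1 1
    · exact toSeries_zero.symm
  | succ n ih =>
    rw [pow_succ, pow_succ, Matrix.mul_apply, Matrix.mul_apply, toSeries_sum,
      MonoidAlgebra.coeff_sum, Finsupp.coe_finsetSum]
    exact Finset.sum_congr rfl fun r _ => by
      rw [coeff_mul_eq_series_mul, ih, hG, series_mul_toSeries]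

theorem realises_of_eq_add_mulVec [TopologicalSpace K] (hM : IsGraded M) {A : Aut K M Q}
    {G : Matrix Q Q (CauchySeries K N)} (hG : ∀ p q, (A.E p q).coeff = (G p q).toSeries)
    {β : Q → CauchySeries K N} (hβ : β = (fun q => C (A.T q)) + G.mulVec β) :
    A.Realises (toSeries (∑ p, C (A.I p) * β p)) := by
  classical
  obtain ⟨len, len_mul, len_eq_zero⟩ := hM.submonoid N
  have G_apply_one (p q : Q) : G p q 1 = 0 :=
    (toSeries_coe (G p q) 1).symm.trans <| (congrFun (hG p q) 1).symm.trans (A.proper p q)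
  have G_pow_apply {n : ℕ} (p q : Q) {m : N} (hm : len m < n) : (G ^ n) p q m = 0 :=
    pow_apply_eq_zero_of_length_lt len_mul len_eq_zero G_apply_one n p q m hm
  let S (p q : Q) : CauchySeries K N := fun m => ∑ n ∈ Finset.range (len m + 1), (G ^ n) p q m
  have S_apply (p q : Q) (m : N) :
      S p q m = ∑ n ∈ Finset.range (len m + 1), (G ^ n) p q m := rfl
  have hasSum_S (p q : Q) : HasSum (fun n => ((G ^ n) p q).toSeries) (S p q).toSeries :=
    hasSum_toSeries fun m => hasSum_sum_of_ne_finset_zero fun n hn =>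
      G_pow_apply p q (by simpa using hn)
  have β_eq (p : Q) : β p = ∑ q, S p q * C (A.T q) := by
    ext m
    have remainder : (G ^ (len m + 1)).mulVec β p m = 0 := by
      rw [Matrix.mulVec, dotProduct, CauchySeries.sum_apply]
      exact Finset.sum_eq_zero fun q _ => mul_apply_eq_zero_of_length_lt (b := 0) len_mul
        (fun x hx => G_pow_apply p q hx) (fun x hx => absurd hx (Nat.not_lt_zero _))
        (Nat.lt_succ_self _)
    rw [eq_sum_pow_mulVec_add hβ (len m + 1), Pi.add_apply, CauchySeries.add_apply, remainder,
      add_zero, Finset.sum_apply]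
    simp only [Matrix.mulVec, dotProduct, CauchySeries.sum_apply, mul_C_apply, S_apply,
      Finset.sum_mul]
    exact Finset.sum_comm
  refine ⟨fun p q => (S p q).toSeries, fun p q => ?_, ?_⟩
  · simpa only [← coeff_pow_eq_toSeries hG] using hasSum_S p q
  · ext m
    simp only [β_eq, Finset.mul_sum, toSeries_sum, Finset.sum_apply, toSeries_C_mul,
      toSeries_mul_C, mul_assoc]

end Aut

open CauchySeries RatExp in
theorem StdAut.IsLabelling.realises_toSeries {K M Q : Type*} [Semiring K] [TopologicalSpace K]
    [IsTopologicalSemiring K] [T2Space K] [Monoid M] [Fintype Q] {N : Submonoid M}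
    [Finset.HasMulAntidiagonal N] {A : StdAut K M Q} {E : RatExp K M} {ℓ : Q → RatExp K M}
    (h : A.IsLabelling E ℓ) (hK : IsStrong K) (hM : IsGraded M) (hE : E.Valid)
    (hℓ : ∀ q, (ℓ q).Valid) (hN : ∀ p q, ∀ m ∉ N, (A.toAut.E p q).coeff m = 0) :
    A.toAut.Realises (E.seriesOn N).toSeries := by
  let β : Option Q → CauchySeries K N := fun i => (i.elim E ℓ).seriesOn N
  let G : Matrix (Option Q) (Option Q) (CauchySeries K N) := A.toAut.E.map (restrict N)
  have hG (p q) : (A.toAut.E p q).coeff = (G p q).toSeries :=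
    eq_toSeries (hN p q) fun _ => rfl
  have hβ : β = (fun q => C (A.toAut.T q)) + G.mulVec β := by
    funext i
    rw [Pi.add_apply, Matrix.mulVec, dotProduct, Fintype.sum_option]
    cases i with
    | none =>
      calc E.seriesOn N
          = C A.c + ∑ q, restrict N (A.J q) * (ℓ q).seriesOn N := by
            rw [← sumSeriesOn_pushforward, h.J_eq, h.c_eq, seriesOn_eq N hK hM hE]
        _ = C A.c + (restrict N 0 * E.seriesOn N + _) := by
            rw [map_zero, zero_mul, zero_add]; rfl
    | some p =>
      calc (ℓ p).seriesOn N
          = C (A.U p) + ∑ q, restrict N (A.F p q) * (ℓ q).seriesOn N := by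
            rw [← sumSeriesOn_pushforward, h.F_eq, h.U_eq, seriesOn_eq N hK hM (hℓ p)]
        _ = C (A.U p) + (restrict N 0 * E.seriesOn N + _) := by
            rw [map_zero, zero_mul, zero_add]; rfl
  have initial : ∑ i, C (A.toAut.I i) * β i = E.seriesOn N := by
    rw [Fintype.sum_option]
    simp [toAut, β]
  exact initial ▸ Aut.realises_of_eq_add_mulVec hM hG hβ

theorem RatExp.seriesDefined_and_realises {K M : Type*} [Semiring K] [TopologicalSpace K]
    [IsTopologicalSemiring K] [T2Space K] [Monoid M] (hK : IsStrong K) (hM : IsGraded M)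
    {E : RatExp K M} (hE : E.Valid) : E.SeriesDefined ∧ E.term.toAut.Realises E.series := by
  let support : Set M := ⋃ (p) (q), ((E.term.toAut.E p q).coeff.support : Set M)
  have finite_support : support.Finite :=
    Set.finite_iUnion fun p => Set.finite_iUnion fun q => Finset.finite_toSet _
  have one_notMem_support : 1 ∉ support := by
    simp [support, Aut.proper]
  obtain ⟨_⟩ := hM.nonempty_hasMulAntidiagonal_closure (E.finite_atoms.union finite_support)
    (fun h => h.elim E.one_notMem_atoms one_notMem_support)
  obtain ⟨defined, eq⟩ := seriesDefined_and_series_eq hK hM hE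
    (Set.subset_union_left.trans
      (Submonoid.subset_closure : E.atoms ∪ support ⊆ Submonoid.closure (E.atoms ∪ support)))
  refine ⟨defined, eq ▸ (isLabelling_term E).realises_toSeries hK hM hE
    (fun H => hE.of_mem_derTer H.2) fun p q m hm => by_contra fun hne => hm ?_⟩
  exact Submonoid.subset_closure (Or.inr (Set.mem_iUnion₂.2 ⟨p, q, Finsupp.mem_support_iff.2 hne⟩))

end WRat

end

theorem theoremt {K : Type*} {M : Type*} [Semiring K] [TopologicalSpace K]
    [IsTopologicalSemiring K] [T2Space K] (hK : WRat.IsStrong K)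
    [Monoid M] (hM : WRat.IsGraded M)
    (E : WRat.RatExp K M) (hE : E.Valid) :
    -- the construction makes sense: the natural maps by which it merges states are morphisms
    (∀ F G : WRat.RatExp K M, E = .add F G →
      WRat.Aut.IsMorphism (F.term.add G.term).toAut (F.add G).term.toAut
        (Option.map (WRat.RatExp.addMap F G))) ∧
    (∀ F G : WRat.RatExp K M, E = .mul F G →
      WRat.Aut.IsMorphism (F.term.mul G.term).toAut (F.mul G).term.toAut
        (Option.map (WRat.RatExp.mulMap F G))) ∧
    -- it yields a standard automaton, which realises the series denoted by `E`
    E.term.toAut.IsStandard none ∧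
    E.SeriesDefined ∧ E.term.toAut.Realises E.series ∧
    -- and which is a quotient of the standard automaton of `E`
    WRat.Aut.IsQuotient E.term.toAut E.stan.toAut :=
  have ⟨defined, realises⟩ := WRat.RatExp.seriesDefined_and_realises hK hM hE
  ⟨fun F G _ => WRat.RatExp.isMorphism_addMap F G, fun F G _ => WRat.RatExp.isMorphism_mulMap F G,
    E.term.toAut_isStandard, defined, realises, ⟨_, E.isMorphism_posMap⟩⟩
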